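/- Let $X$ be a complex Banach space, let $T$ be a bounded linear operator on $X$, and let $T^*$ be its adjoint on the dual space $X^*$, $T^*\varphi=\varphi\circ T$. For a bounded operator $A$ on a complex Banach space write $R(A)$ for its range and set $$d(A)=\inf\{q\in\mathbb{N} : R(A^q)=R(A^{q+1})\},\qquad d_e(A)=\inf\{n\in\mathbb{N} : \dim\big(R(A^n)/R(A^{n+1})\big)<\infty\},$$ where $\mathbb{N}=\{0,1,2,\dots\}$ and $\inf\emptyset=\infty$. The descent spectrum and the essential descent spectrum of $A$ are $$\sigma_{desc}(A)=\{\lambda\in\mathbb{C} : d(\lambda-A)=\infty\},\qquad \sigma^e_{desc}(A)=\{\lambda\in\mathbb{C} : d_e(\lambda-A)=\infty\}.$$ The operator $A$ has the single-valued extension property (SVEP) at $\lambda_0\in\mathbb{C}$ if, for every connected open neighbourhood $U$ of $\lambda_0$, the only analytic function $f$ on $U$, with values in the space on which $A$ acts, satisfying $(\lambda-A)f(\lambda)=0$ for all $\lambda\in U$ is $f\equiv 0$. Let $\mathcal{S}(A)$ be the set of all $\lambda\in\mathbb{C}$ at which $A$ does not have the SVEP; $A$ is said to have the SVEP if $\mathcal{S}(A)=\emptyset$.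 Then $$\sigma_{desc}(T)=\sigma^e_{desc}(T)\cup\overline{\mathcal{S}(T^*)}.$$ In particular, if $T^*$ has the SVEP, then $\sigma_{desc}(T)=\sigma^e_{desc}(T)$. -/

import Mathlib

/-!  Descent, essential descent and the single-valued extension property (SVEP)
of a bounded linear operator on a complex normed space. -/

namespace DescentSpectrum

noncomputable section

variable {X : Type*} [NormedAddCommGroup X] [NormedSpace ℂ X]

/-- The range `R(T ^ n)` of the `n`-th power of `T`. -/
def powRange (T : X →L[ℂ] X) (n : ℕ) : Submodule ℂ X :=
  LinearMap.range ((T ^ n : X →L[ℂ] X) : X →ₗ[ℂ] X)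

/-- The descent `d(T) = inf {q : R(T ^ q) = R(T ^ (q + 1))}`, equal to `⊤` (infinity) if there is
no such `q`. -/
def descent (T : X →L[ℂ] X) : ℕ∞ :=
  sInf ((fun q : ℕ => (q : ℕ∞)) '' {q : ℕ | powRange T q = powRange T (q + 1)})

/-- The dimension `c_n(T) = dim (R(T ^ n) / R(T ^ (n + 1)))`, as a cardinal. -/
def rangeQuotientDim (T : X →L[ℂ] X) (n : ℕ) : Cardinal :=
  Module.rank ℂ (powRange T n ⧸ (powRange T (n + 1)).submoduleOf (powRange T n))

/-- The essential descent `d_e(T) = inf {n : c_n(T) < ∞}`, equal to `⊤` (infinity) if there is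
no such `n`. -/
def essentialDescent (T : X →L[ℂ] X) : ℕ∞ :=
  sInf ((fun n : ℕ => (n : ℕ∞)) '' {n : ℕ | rangeQuotientDim T n < Cardinal.aleph0})

/-- The descent spectrum `{z : d(z - T) = ∞}`. -/
def descentSpectrum (T : X →L[ℂ] X) : Set ℂ :=
  {z | descent (z • ContinuousLinearMap.id ℂ X - T) = ⊤}

/-- The essential descent spectrum `{z : d_e(z - T) = ∞}`. -/
def essentialDescentSpectrum (T : X →L[ℂ] X) : Set ℂ :=
  {z | essentialDescent (z • ContinuousLinearMap.id ℂ X - T) = ⊤}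

/-- `T` has the SVEP at `z₀`: on each connected open neighbourhood `U` of `z₀`, the only analytic
function `f : U → X` with `(z - T) f(z) = 0` on `U` is the zero function. -/
def HasSVEPAt (T : X →L[ℂ] X) (z₀ : ℂ) : Prop :=
  ∀ U : Set ℂ, IsOpen U → IsConnected U → z₀ ∈ U → ∀ f : ℂ → X, AnalyticOnNhd ℂ f U →
    (∀ z ∈ U, (z • ContinuousLinearMap.id ℂ X - T) (f z) = 0) → ∀ z ∈ U, f z = 0

/-- The set `S(T)` of the points at which `T` does not have the SVEP. -/
def svepFailureSet (T : X →L[ℂ] X) : Set ℂ :=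
  {z | ¬ HasSVEPAt T z}

/-- `T` has the SVEP if `S(T)` is empty. -/
def HasSVEP (T : X →L[ℂ] X) : Prop :=
  svepFailureSet T = ∅

/-- The (Banach space) adjoint `T* : X* → X*`, `φ ↦ φ ∘ T`. -/
def adjointOp (T : X →L[ℂ] X) : StrongDual ℂ X →L[ℂ] StrongDual ℂ X :=
  ContinuousLinearMap.precomp ℂ T

end

end DescentSpectrum

open Filter Topology

namespace DescentSpectrum

/-! Put `A = z₀ - T` and `M n = R(A) + N(A ^ n)`. Since `A ^ n` induces `X / M n ≅ R(A ^ n) / R(A ^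
(n + 1))`, the descent is finite iff some `M n = X`, and the essential descent iff some `M n` has
finite codimension.

If only the essential descent is finite, the `M n` stabilize at a proper subspace `M d`. A nonzero
continuous functional killing it kills every `N(A ^ m)`, and such functionals can be divided by `A*`
again and again with norm control (`exists_dual_chain`). The power series in `z₀ - z` with the
resulting coefficients is an analytic eigenvector of `T*`, so SVEP fails at `z₀`.

Conversely, `M q = X` makes `A - w` surjective for small `w ≠ 0` (`exists_surjective_sub_smul_id`).
So `z - T*` is injective on a punctured disc, and the identity theorem gives SVEP on the whole disc.
-/

/-- A functional vanishing on the kernel of a surjection of Banach spaces factors through it, with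
a uniform bound on the norm of the factor. -/
theorem exists_dual_factor {E F : Type*} [NormedAddCommGroup E] [NormedSpace ℂ E] [CompleteSpace E]
    [NormedAddCommGroup F] [NormedSpace ℂ F] [CompleteSpace F] (S : E →L[ℂ] F)
    (hS : Function.Surjective S) :
    ∃ C : ℝ, 0 < C ∧ ∀ η : StrongDual ℂ E, (∀ e, S e = 0 → η e = 0) →
      ∃ ψ : StrongDual ℂ F, (∀ e, ψ (S e) = η e) ∧ ‖ψ‖ ≤ C * ‖η‖ := by
  obtain ⟨C, hC, h⟩ := S.exists_preimage_norm_le hS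
  choose r hr hrC using h
  refine ⟨C, hC, fun η hη => ?_⟩
  have key : ∀ e e', S e = S e' → η e = η e' := fun e e' h => by
    rw [← sub_eq_zero, ← map_sub]
    exact hη _ (by rw [map_sub, h, sub_self])
  let ψ : F →ₗ[ℂ] ℂ :=
    { toFun := fun y => η (r y)
      map_add' := fun x y => by rw [← map_add]; exact key _ _ (by simp only [map_add, hr])
      map_smul' := fun c x => by
        rw [RingHom.id_apply, ← map_smul]; exact key _ _ (by simp only [map_smul, hr]) }
  have hψ : ∀ y, ‖ψ y‖ ≤ C * ‖η‖ * ‖y‖ := fun y =>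
    calc ‖η (r y)‖ ≤ ‖η‖ * ‖r y‖ := η.le_opNorm _
      _ ≤ ‖η‖ * (C * ‖y‖) := by gcongr; exact hrC y
      _ = C * ‖η‖ * ‖y‖ := by ring
  exact ⟨ψ.mkContinuous _ hψ, fun e => key _ _ (hr _), ψ.mkContinuous_norm_le (by positivity) hψ⟩

/-- Surjectivity of a bounded operator between Banach spaces is stable under small
perturbations. -/
theorem exists_surjective_of_norm_sub_lt {E F : Type*} [NormedAddCommGroup E] [NormedSpace ℂ E]
    [CompleteSpace E] [NormedAddCommGroup F] [NormedSpace ℂ F] [CompleteSpace F] (S : E →L[ℂ] F)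
    (hS : Function.Surjective S) :
    ∃ ε : ℝ, 0 < ε ∧ ∀ R : E →L[ℂ] F, ‖R - S‖ < ε → Function.Surjective R := by
  have hrange : S.range = ⊤ := LinearMap.range_eq_top.2 hS
  let N := S.nonlinearRightInverseOfSurjective hrange
  have hN : 0 < N.nnnorm := S.nonlinearRightInverseOfSurjective_nnnorm_pos hrange
  refine ⟨(N.nnnorm : ℝ)⁻¹, by positivity, fun R hR => ?_⟩
  have happ : ApproximatesLinearOn R S Set.univ ‖R - S‖₊ := fun x _ y _ => by
    have := (R - S).le_opNorm (x - y)
    simpa [map_sub, sub_sub_sub_comm] using this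
  have hball := happ.surjOn_closedBall_of_nonlinearRightInverse N zero_le_one
    (Set.subset_univ (Metric.closedBall 0 1))
  have hpos : 0 < ((N.nnnorm : ℝ)⁻¹ - ‖R - S‖₊) * 1 := by simpa using hR
  -- The image of the unit ball contains a ball, and a subspace with nonempty interior is
  -- everything.
  refine LinearMap.range_eq_top.1 (Submodule.eq_top_of_nonempty_interior' R.range ?_)
  refine ⟨R 0, mem_interior_iff_mem_nhds.2
    (mem_of_superset (Metric.closedBall_mem_nhds _ hpos) fun y hy => ?_)⟩
  obtain ⟨x, -, hx⟩ := hball hy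
  exact ⟨x, hx⟩

section Operator

variable {X : Type*} [NormedAddCommGroup X] [NormedSpace ℂ X]

theorem adjointOp_apply (T : X →L[ℂ] X) (φ : StrongDual ℂ X) (x : X) :
    adjointOp T φ x = φ (T x) := rfl

theorem mem_powRange {T : X →L[ℂ] X} {n : ℕ} {y : X} :
    y ∈ powRange T n ↔ ∃ x, (T ^ n) x = y := Iff.rfl

theorem sInf_natCast_image_eq_top (s : Set ℕ) :
    sInf ((fun q : ℕ => (q : ℕ∞)) '' s) = ⊤ ↔ s = ∅ := by
  rw [sInf_eq_top, Set.forall_mem_image, Set.eq_empty_iff_forall_notMem]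
  exact forall₂_congr fun n _ => by simp

theorem descent_eq_top {T : X →L[ℂ] X} :
    descent T = ⊤ ↔ ∀ q, powRange T q ≠ powRange T (q + 1) := by
  rw [descent, sInf_natCast_image_eq_top, Set.eq_empty_iff_forall_notMem]; rfl

theorem essentialDescent_eq_top {T : X →L[ℂ] X} :
    essentialDescent T = ⊤ ↔ ∀ n, ¬ rangeQuotientDim T n < Cardinal.aleph0 := by
  rw [essentialDescent, sInf_natCast_image_eq_top, Set.eq_empty_iff_forall_notMem]; rfl

/-- The subspace `R(A) + N(A ^ n)`. -/
def rangeSupKerPow (A : X →L[ℂ] X) (n : ℕ) : Submodule ℂ X :=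
  LinearMap.range (A : X →ₗ[ℂ] X) ⊔ LinearMap.ker ((A ^ n : X →L[ℂ] X) : X →ₗ[ℂ] X)

theorem mem_rangeSupKerPow {A : X →L[ℂ] X} {n : ℕ} {y : X} :
    y ∈ rangeSupKerPow A n ↔ ∃ x u, (A ^ n) u = 0 ∧ A x + u = y := by
  rw [rangeSupKerPow, Submodule.mem_sup]
  constructor
  · rintro ⟨_, ⟨x, rfl⟩, u, hu, rfl⟩
    exact ⟨x, u, hu, rfl⟩
  · rintro ⟨x, u, hu, rfl⟩
    exact ⟨A x, ⟨x, rfl⟩, u, hu, rfl⟩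

theorem pow_apply_eq_zero_of_le {A : X →L[ℂ] X} {m n : ℕ} (h : m ≤ n) {x : X}
    (hx : (A ^ m) x = 0) : (A ^ n) x = 0 := by
  obtain ⟨k, rfl⟩ := Nat.exists_eq_add_of_le' h
  rw [pow_add, mul_apply_eq_comp, hx, map_zero]

theorem rangeSupKerPow_mono (A : X →L[ℂ] X) : Monotone (rangeSupKerPow A) := fun _ _ h =>
  sup_le_sup_left (fun _ hx => pow_apply_eq_zero_of_le h hx) _

/-- `A ^ n y = A ^ (n + 1) x` says exactly that `y - A x` lies in `N(A ^ n)`. -/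
theorem mem_rangeSupKerPow_iff_pow_apply_mem {A : X →L[ℂ] X} {n : ℕ} {y : X} :
    y ∈ rangeSupKerPow A n ↔ (A ^ n) y ∈ powRange A (n + 1) := by
  rw [mem_rangeSupKerPow, mem_powRange]
  constructor
  · rintro ⟨x, u, hu, rfl⟩
    exact ⟨x, by rw [map_add, hu, add_zero, pow_succ, mul_apply_eq_comp]⟩
  · rintro ⟨x, hx⟩
    refine ⟨x, y - A x, ?_, by abel⟩
    rw [map_sub, ← hx, pow_succ, mul_apply_eq_comp, sub_self]

theorem powRange_eq_succ_iff {A : X →L[ℂ] X} {n : ℕ} :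
    powRange A n = powRange A (n + 1) ↔ rangeSupKerPow A n = ⊤ := by
  rw [Submodule.eq_top_iff']
  simp only [mem_rangeSupKerPow_iff_pow_apply_mem]
  constructor
  · intro h x
    rw [← h]
    exact ⟨x, rfl⟩
  · refine fun h => le_antisymm ?_ ?_
    · rintro _ ⟨x, rfl⟩
      exact h x
    · rintro _ ⟨x, rfl⟩
      exact ⟨A x, by simp [pow_succ]⟩

theorem finiteDimensional_quotient_rangeSupKerPow {A : X →L[ℂ] X} {n : ℕ}
    (h : rangeQuotientDim A n < Cardinal.aleph0) :
    FiniteDimensional ℂ (X ⧸ rangeSupKerPow A n) := by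
  have hfin := Module.rank_lt_aleph0_iff.1 h
  let g : X →ₗ[ℂ] powRange A n ⧸ (powRange A (n + 1)).submoduleOf (powRange A n) :=
    (Submodule.mkQ _).comp ((A ^ n : X →L[ℂ] X) : X →ₗ[ℂ] X).rangeRestrict
  have hg : LinearMap.ker g = rangeSupKerPow A n := by
    ext y
    rw [mem_rangeSupKerPow_iff_pow_apply_mem]
    exact Submodule.Quotient.mk_eq_zero _
  rw [← hg]
  exact g.quotKerEquivRange.symm.finiteDimensional

/-- If the essential descent is finite, the subspaces `R(A) + N(A ^ n)` have finite codimension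
and are constant from some point on. -/
theorem exists_rangeSupKerPow_stable {A : X →L[ℂ] X} {n : ℕ}
    (h : rangeQuotientDim A n < Cardinal.aleph0) :
    ∃ d, FiniteDimensional ℂ (X ⧸ rangeSupKerPow A d) ∧
      ∀ m, rangeSupKerPow A m ≤ rangeSupKerPow A d := by
  have hfin := finiteDimensional_quotient_rangeSupKerPow h
  -- Above index `n` the chain lives in a finite-dimensional quotient, so it stops growing.
  obtain ⟨k, hk⟩ := monotone_stabilizes_iff_noetherian.2
    (inferInstance : IsNoetherian ℂ (X ⧸ rangeSupKerPow A n))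
    ⟨fun k => (rangeSupKerPow A (n + k)).map (rangeSupKerPow A n).mkQ, fun i j hij =>
      Submodule.map_mono (rangeSupKerPow_mono A (by omega))⟩
  refine ⟨n + k, ?_, fun m => ?_⟩
  · have hle : rangeSupKerPow A n ≤ rangeSupKerPow A (n + k) := rangeSupKerPow_mono A (by omega)
    exact Module.Finite.of_surjective (Submodule.factor hle) (Submodule.factor_surjective hle)
  · have h1 := congrArg (Submodule.comap (rangeSupKerPow A n).mkQ) (hk (k + m) (by omega))
    change Submodule.comap _ (Submodule.map _ _) = Submodule.comap _ (Submodule.map _ _) at h1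
    rw [Submodule.comap_map_mkQ, Submodule.comap_map_mkQ,
      sup_eq_right.2 (rangeSupKerPow_mono A (by omega)),
      sup_eq_right.2 (rangeSupKerPow_mono A (by omega))] at h1
    rw [h1]
    exact rangeSupKerPow_mono A (by omega)

/-- A geometrically bounded chain of generalized eigenvectors produces a nonzero analytic family
of eigenvectors. -/
theorem not_hasSVEPAt_of_chain [CompleteSpace X] (T : X →L[ℂ] X) (z₀ : ℂ) (φ : ℕ → X)
    (h0 : (z₀ • ContinuousLinearMap.id ℂ X - T) (φ 0) = 0)
    (hsucc : ∀ n, (z₀ • ContinuousLinearMap.id ℂ X - T) (φ (n + 1)) = φ n) (hne : φ 0 ≠ 0)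
    {C D : ℝ} (hC : 0 < C) (hφ : ∀ n, ‖φ n‖ ≤ C ^ n * D) : ¬ HasSVEPAt T z₀ := by
  intro hT
  set B := z₀ • ContinuousLinearMap.id ℂ X - T with hB
  -- On the disc of radius `1 / (2C)` the growth `C ^ n` leaves a convergent majorant `2⁻ⁿ D`.
  have hr : 0 < (2 * C)⁻¹ := by positivity
  let F : ℕ → ℂ → X := fun n z => (z₀ - z) ^ n • φ n
  have hu : Summable fun n : ℕ => (2⁻¹ : ℝ) ^ n * D :=
    (summable_geometric_of_lt_one (by norm_num) (by norm_num)).mul_right D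
  have hF : ∀ n, ∀ z ∈ Metric.ball z₀ (2 * C)⁻¹, ‖F n z‖ ≤ (2⁻¹ : ℝ) ^ n * D := fun n z hz => by
    rw [Metric.mem_ball, dist_eq_norm, norm_sub_rev] at hz
    calc ‖F n z‖ = ‖z₀ - z‖ ^ n * ‖φ n‖ := by rw [norm_smul, norm_pow]
      _ ≤ ((2 * C)⁻¹) ^ n * (C ^ n * D) := by gcongr; exact hφ n
      _ = ((2 * C)⁻¹ * C) ^ n * D := by rw [mul_pow]; ring
      _ = (2⁻¹ : ℝ) ^ n * D := by congr 2; field_simp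
  have hdiff : DifferentiableOn ℂ (fun z => ∑' n, F n z) (Metric.ball z₀ (2 * C)⁻¹) :=
    Complex.differentiableOn_tsum_of_summable_norm hu
      (fun n => by dsimp only [F]; fun_prop) Metric.isOpen_ball hF
  have hz := hT _ Metric.isOpen_ball
    ((convex_ball z₀ _).isConnected ⟨z₀, Metric.mem_ball_self hr⟩) (Metric.mem_ball_self hr)
    _ (hdiff.analyticOnNhd Metric.isOpen_ball) (fun z hz => ?_) z₀ (Metric.mem_ball_self hr)
  · apply hne
    rw [tsum_eq_single 0 fun n hn => by simp [F, hn]] at hz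
    simpa [F] using hz
  · have hsum : Summable fun n => F n z := Summable.of_norm_bounded hu fun n => hF n z hz
    have h1 : B (∑' n, F n z) = (z₀ - z) • ∑' n, F n z := by
      rw [B.map_tsum hsum, (B.summable hsum).tsum_eq_zero_add, ← hsum.tsum_const_smul]
      simp only [F, map_smul, h0, hsucc, smul_zero, zero_add, smul_smul, pow_succ']
    have h2 : z • ContinuousLinearMap.id ℂ X - T = B - (z₀ - z) • ContinuousLinearMap.id ℂ X := by
      rw [hB, sub_smul]; abel
    rw [h2, sub_apply, h1]
    simp

theorem smul_id_sub_adjointOp (T : X →L[ℂ] X) (z : ℂ) :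
    z • ContinuousLinearMap.id ℂ (StrongDual ℂ X) - adjointOp T =
      adjointOp (z • ContinuousLinearMap.id ℂ X - T) := by
  ext φ x
  simp [adjointOp_apply]

/-- If `R(A) + N(A ^ d)` is a proper subspace of finite codimension containing every `N(A ^ m)`,
then the adjoint of `A` has a geometrically bounded chain of generalized eigenvectors. -/
theorem exists_dual_chain [CompleteSpace X] (A : X →L[ℂ] X) (d : ℕ)
    [FiniteDimensional ℂ (X ⧸ rangeSupKerPow A d)]
    (hker : ∀ m x, (A ^ m) x = 0 → x ∈ rangeSupKerPow A d) (hne : rangeSupKerPow A d ≠ ⊤) :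
    ∃ (φ : ℕ → StrongDual ℂ X) (C : ℝ), 0 < C ∧ φ 0 ≠ 0 ∧ adjointOp A (φ 0) = 0 ∧
      (∀ n, adjointOp A (φ (n + 1)) = φ n) ∧ ∀ n, ‖φ n‖ ≤ C ^ n * ‖φ 0‖ := by
  set M := rangeSupKerPow A d with hM
  obtain ⟨F, hF⟩ := M.exists_isCompl
  have : FiniteDimensional ℂ F := (M.quotientEquivOfIsCompl F hF).finiteDimensional
  have : CompleteSpace F := FiniteDimensional.complete ℂ F
  let N : Submodule ℂ X := LinearMap.ker ((A ^ d : X →L[ℂ] X) : X →ₗ[ℂ] X)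
  have hNc : IsClosed (N : Set X) := (A ^ d).isClosed_ker
  have : CompleteSpace N := hNc.completeSpace_coe
  -- Adding a finite-dimensional complement `F` makes `S` onto, so continuity of functionals comes
  -- from the open mapping theorem and closedness of `M` is never needed.
  let S : X × N × F →L[ℂ] X := A.coprod (N.subtypeL.coprod F.subtypeL)
  have hSapp : ∀ x u g, S (x, u, g) = (A x + u) + g := fun x u g => by
    simp [S, add_assoc]
  have hmem : ∀ (x : X) (u : N), A x + u ∈ M := fun x u => mem_rangeSupKerPow.2 ⟨x, u, u.2, rfl⟩
  have hS : Function.Surjective S := fun y => by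
    obtain ⟨m, hm, g, hg, rfl⟩ := Submodule.mem_sup.1 (hF.sup_eq_top ▸ Submodule.mem_top : y ∈ M ⊔ F)
    obtain ⟨x, u, hu, rfl⟩ := mem_rangeSupKerPow.1 hm
    exact ⟨(x, ⟨u, hu⟩, ⟨g, hg⟩), hSapp _ _ _⟩
  have hS0 : ∀ x u g, S (x, u, g) = 0 → g = 0 ∧ (A ^ (d + 1)) x = 0 := fun x u g h => by
    rw [hSapp] at h
    have hg : (g : X) = 0 := by
      refine Submodule.disjoint_def.1 hF.disjoint _ ?_ g.2
      rw [← neg_eq_of_add_eq_zero_right h]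
      exact M.neg_mem (hmem x u)
    rw [hg, add_zero] at h
    refine ⟨Subtype.ext hg, ?_⟩
    rw [pow_succ, mul_apply_eq_comp, eq_neg_of_add_eq_zero_left h, map_neg,
      show (A ^ d) u = 0 from u.2, neg_zero]
  obtain ⟨C, hC, hlift⟩ := exists_dual_factor S hS
  -- `K` consists of functionals that `A*` can divide without leaving `K`: the quotient is `ψ (A x +
  -- u + g) = φ x`.
  let K : Set (StrongDual ℂ X) := {φ | ∀ m x, (A ^ m) x = 0 → φ x = 0}
  have hstep : ∀ φ ∈ K, ∃ ψ ∈ K, adjointOp A ψ = φ ∧ ‖ψ‖ ≤ C * ‖φ‖ := fun φ hφ => by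
    obtain ⟨ψ, hψ, hψC⟩ := hlift (φ.comp (ContinuousLinearMap.fst ℂ X (N × F)))
      fun ⟨x, u, g⟩ h => hφ _ _ (hS0 x u g h).2
    have hψ' : ∀ x (u : N), ψ (A x + u) = φ x := fun x u => by
      simpa [hSapp] using hψ (x, u, 0)
    refine ⟨ψ, fun m y hy => ?_, ?_, hψC.trans ?_⟩
    · obtain ⟨x, u, hu, rfl⟩ := mem_rangeSupKerPow.1 (hker m y hy)
      rw [hψ' x ⟨u, hu⟩]
      -- Both `A x + u` and `u` are killed by `A ^ max m d`, hence so is `A x`.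
      refine hφ (max m d + 1) x ?_
      have h1 := pow_apply_eq_zero_of_le (le_max_left m d) hy
      rwa [map_add, pow_apply_eq_zero_of_le (le_max_right m d) hu, add_zero,
        ← mul_apply_eq_comp, ← pow_succ] at h1
    · ext x
      rw [adjointOp_apply]
      simpa using hψ' x 0
    · gcongr
      refine (φ.opNorm_comp_le _).trans ?_
      exact mul_le_of_le_one_right (norm_nonneg _) (ContinuousLinearMap.norm_fst_le ..)
  obtain ⟨φ₀, hφ₀M, hφ₀⟩ : ∃ φ₀ : StrongDual ℂ X, (∀ y ∈ M, φ₀ y = 0) ∧ φ₀ ≠ 0 := by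
    have hFne : F ≠ ⊥ := fun h => hne (by simpa [h] using hF.sup_eq_top)
    obtain ⟨g, hgF, hg⟩ := F.exists_mem_ne_zero_of_ne_bot hFne
    obtain ⟨l, hl⟩ := exists_dual_vector ℂ (⟨g, hgF⟩ : F) (by simpa using hg)
    -- `φ₀` reads off the `F`-component, so it vanishes on `M`.
    obtain ⟨ψ, hψ, -⟩ := hlift (l.comp ((ContinuousLinearMap.snd ℂ N F).comp
      (ContinuousLinearMap.snd ℂ X (N × F)))) fun ⟨x, u, g⟩ h => by simp [(hS0 x u g h).1]
    refine ⟨ψ, fun y hy => ?_, fun h => ?_⟩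
    · obtain ⟨x, u, hu, rfl⟩ := mem_rangeSupKerPow.1 hy
      simpa [hSapp] using hψ (x, ⟨u, hu⟩, 0)
    · have := hψ (0, 0, ⟨g, hgF⟩)
      exact hg (by simpa [h, hl.2, eq_comm] using this)
  have hφ₀K : φ₀ ∈ K := fun m x hx => hφ₀M x (hker m x hx)
  choose! s hsK hs hsC using hstep
  have hK : ∀ n, s^[n] φ₀ ∈ K := fun n => by
    induction n with
    | zero => exact hφ₀K
    | succ n ih => rw [Function.iterate_succ_apply']; exact hsK _ ih
  refine ⟨fun n => s^[n] φ₀, C, hC, hφ₀, ?_, fun n => ?_, fun n => ?_⟩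
  · ext x
    exact hφ₀M _ (by simpa using hmem x 0)
  · simp only [Function.iterate_succ_apply']
    exact hs _ (hK n)
  · change ‖s^[n] φ₀‖ ≤ C ^ n * ‖φ₀‖
    induction n with
    | zero => simp
    | succ n ih =>
      rw [Function.iterate_succ_apply']
      calc _ ≤ C * ‖s^[n] φ₀‖ := hsC _ (hK n)
        _ ≤ C * (C ^ n * ‖φ₀‖) := by gcongr
        _ = _ := by rw [pow_succ]; ring

/-- If the descent of `z₀ - T` is infinite and its essential descent is finite, then the adjoint
of `T` does not have the SVEP at `z₀`. -/
theorem not_hasSVEPAt_adjointOp [CompleteSpace X] {T : X →L[ℂ] X} {z₀ : ℂ}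
    (hd : z₀ ∈ descentSpectrum T) (he : z₀ ∉ essentialDescentSpectrum T) :
    ¬ HasSVEPAt (adjointOp T) z₀ := by
  rw [essentialDescentSpectrum, Set.mem_ofPred_eq, essentialDescent_eq_top] at he
  push Not at he
  obtain ⟨n, hn⟩ := he
  obtain ⟨d, hfin, hstab⟩ := exists_rangeSupKerPow_stable hn
  obtain ⟨φ, C, hC, hne, h0, hsucc, hb⟩ := exists_dual_chain _ d
    (fun m x hx => hstab m (Submodule.mem_sup_right hx))
    fun h => descent_eq_top.1 hd d (powRange_eq_succ_iff.2 h)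
  exact not_hasSVEPAt_of_chain _ _ φ (by rwa [smul_id_sub_adjointOp])
    (by simpa only [smul_id_sub_adjointOp] using hsucc) hne hC hb

/-- If `A` has finite descent, then `A - w` is surjective for all small `w ≠ 0`. -/
theorem exists_surjective_sub_smul_id [CompleteSpace X] {A : X →L[ℂ] X} {q : ℕ}
    (h : powRange A q = powRange A (q + 1)) :
    ∃ ε : ℝ, 0 < ε ∧ ∀ w : ℂ, w ≠ 0 → ‖w‖ < ε →
      Function.Surjective (A - w • ContinuousLinearMap.id ℂ X) := by
  rw [powRange_eq_succ_iff] at h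
  let N : Submodule ℂ X := LinearMap.ker ((A ^ q : X →L[ℂ] X) : X →ₗ[ℂ] X)
  have hNc : IsClosed (N : Set X) := (A ^ q).isClosed_ker
  have : CompleteSpace N := hNc.completeSpace_coe
  have hS : Function.Surjective (A.coprod N.subtypeL) := fun y => by
    obtain ⟨x, u, hu, rfl⟩ := mem_rangeSupKerPow.1 (h ▸ Submodule.mem_top : y ∈ rangeSupKerPow A q)
    exact ⟨(x, ⟨u, hu⟩), by simp⟩
  obtain ⟨ε, hε, H⟩ := exists_surjective_of_norm_sub_lt _ hS
  refine ⟨ε, hε, fun w hw hwε y => ?_⟩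
  set B := A - w • ContinuousLinearMap.id ℂ X with hB
  -- The kernel summand stays that of `A ^ q`; only the first summand is perturbed.
  have hnorm : ‖B.coprod N.subtypeL - A.coprod N.subtypeL‖ < ε := by
    refine lt_of_le_of_lt (ContinuousLinearMap.opNorm_le_bound _ (norm_nonneg w) fun p => ?_) hwε
    have : (B.coprod N.subtypeL - A.coprod N.subtypeL) p = -(w • p.1) := by simp [hB]
    rw [this, norm_neg, norm_smul]
    gcongr
    exact norm_fst_le p
  obtain ⟨⟨x, u⟩, rfl⟩ := H _ hnorm y
  -- `B` divides `A ^ q - w ^ q`, so its range contains the kernel of `A ^ q`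
  obtain ⟨P, hP⟩ : B ∣ A ^ q - (w • ContinuousLinearMap.id ℂ X) ^ q :=
    Commute.sub_dvd_pow_sub_pow (by ext x; simp) q
  have hPu : B (P u) = -(w ^ q • (u : X)) := by
    have := congrArg (fun L : X →L[ℂ] X => L u) hP
    have hw' : (w • ContinuousLinearMap.id ℂ X) ^ q = w ^ q • ContinuousLinearMap.id ℂ X := by
      rw [smul_pow]; congr 1; exact one_pow q
    simpa [hw', show (A ^ q) u = 0 from u.2] using this.symm
  refine ⟨x - (w ^ q)⁻¹ • P u, ?_⟩
  rw [map_sub, map_smul, hPu, smul_neg, inv_smul_smul₀ (pow_ne_zero q hw)]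
  simp

theorem notMem_closure_svepFailureSet [CompleteSpace X] {T : X →L[ℂ] X} {z₀ : ℂ}
    (hd : z₀ ∉ descentSpectrum T) : z₀ ∉ closure (svepFailureSet (adjointOp T)) := by
  rw [descentSpectrum, Set.mem_ofPred_eq, descent_eq_top] at hd
  push Not at hd
  obtain ⟨q, hq⟩ := hd
  obtain ⟨ε, hε, H⟩ := exists_surjective_sub_smul_id hq
  have hinj : ∀ z ∈ Metric.ball z₀ ε, z ≠ z₀ → ∀ φ : StrongDual ℂ X,
      (z • ContinuousLinearMap.id ℂ (StrongDual ℂ X) - adjointOp T) φ = 0 → φ = 0 := by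
    intro z hz hne φ hφ
    rw [Metric.mem_ball, dist_eq_norm, norm_sub_rev] at hz
    ext y
    obtain ⟨x, rfl⟩ := H (z₀ - z) (sub_ne_zero.2 hne.symm) hz y
    rw [smul_id_sub_adjointOp] at hφ
    have := congrArg (fun ψ : StrongDual ℂ X => ψ x) hφ
    simpa [adjointOp_apply, sub_smul] using this
  rw [mem_closure_iff_nhds]
  push Not
  refine ⟨Metric.ball z₀ ε, Metric.ball_mem_nhds _ hε, ?_⟩
  refine Set.eq_empty_iff_forall_notMem.2 fun z₁ ⟨hz₁, hfail⟩ => hfail ?_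
  intro U hUo hUc hU f hf heq
  refine hf.eqOn_zero_of_preconnected_of_frequently_eq_zero hUc.isPreconnected hU ?_
  -- Injectivity may fail at `z₀` itself, but zeros accumulating at `z₁` suffice.
  have hne : ∀ᶠ z in 𝓝[≠] z₁, z ≠ z₀ := by
    rcases eq_or_ne z₁ z₀ with rfl | h
    · exact self_mem_nhdsWithin
    · exact mem_nhdsWithin_of_mem_nhds (isOpen_ne.mem_nhds h)
  refine Eventually.frequently ?_
  filter_upwards [hne, mem_nhdsWithin_of_mem_nhds (Metric.isOpen_ball.mem_nhds hz₁),
    mem_nhdsWithin_of_mem_nhds (hUo.mem_nhds hU)] with z h1 h2 h3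
  exact hinj z h2 h1 _ (heq z h3)

theorem essentialDescentSpectrum_subset (T : X →L[ℂ] X) :
    essentialDescentSpectrum T ⊆ descentSpectrum T := by
  intro z hz
  refine descent_eq_top.2 fun q hq => essentialDescent_eq_top.1 hz q ?_
  have : Subsingleton (powRange (z • ContinuousLinearMap.id ℂ X - T) q ⧸
      (powRange (z • ContinuousLinearMap.id ℂ X - T) (q + 1)).submoduleOf
        (powRange (z • ContinuousLinearMap.id ℂ X - T) q)) := by
    rw [Submodule.Quotient.subsingleton_iff, ← hq, Submodule.submoduleOf_self]
  rw [rangeQuotientDim, rank_subsingleton']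
  exact Cardinal.aleph0_pos

end Operator

end DescentSpectrum

theorem mainTheorem1 {X : Type*} [NormedAddCommGroup X] [NormedSpace ℂ X] [CompleteSpace X]
    (T : X →L[ℂ] X) :
    DescentSpectrum.descentSpectrum T =
        DescentSpectrum.essentialDescentSpectrum T ∪
          closure (DescentSpectrum.svepFailureSet (DescentSpectrum.adjointOp T)) ∧
      (DescentSpectrum.HasSVEP (DescentSpectrum.adjointOp T) →
        DescentSpectrum.descentSpectrum T = DescentSpectrum.essentialDescentSpectrum T) := by
  have key : DescentSpectrum.descentSpectrum T =
      DescentSpectrum.essentialDescentSpectrum T ∪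
        closure (DescentSpectrum.svepFailureSet (DescentSpectrum.adjointOp T)) := by
    refine Set.Subset.antisymm (fun z hz => ?_) (Set.union_subset
      (DescentSpectrum.essentialDescentSpectrum_subset T) fun z hz => ?_)
    · by_cases he : z ∈ DescentSpectrum.essentialDescentSpectrum T
      · exact Or.inl he
      · exact Or.inr (subset_closure (DescentSpectrum.not_hasSVEPAt_adjointOp hz he))
    · exact not_imp_not.1 DescentSpectrum.notMem_closure_svepFailureSet hz
  refine ⟨key, fun h => ?_⟩
  rw [DescentSpectrum.HasSVEP] at h
  rw [key, h, closure_empty, Set.union_empty]
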